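/- For $p\in[1,\infty)$ let $J_p$ be the James space, i.e. the real Banach space of all sequences $x=(x(n))_{n\in\mathbb N}$ of real numbers with $\lim_n x(n)=0$ and $$\|x\|_{J_p}=\sup_{p_1<\dots<p_n}\Big(\sum_{i=2}^n|x(p_i)-x(p_{i-1})|^p\Big)^{1/p}<\infty ,$$ where the supremum is over all finite strictly increasing sequences of indices. A map $f\colon X\to Y$ between Banach spaces is called coarse if $\sup\{\|f(x)-f(z)\| : \|x-z\|\le t\}<\infty$ for every $t\ge 0$. For $\alpha\in[0,1]$, it is called linearly expanding at rate $\alpha$ if for every $L>0$ there is $C>0$ such that, for all $x,z\in X$, $$\|x-z\|\ge L\max\{\|x\|^\alpha,\|z\|^\alpha\}+L\quad\text{implies}\quad \|f(x)-f(z)\|\ge \frac{\|x-z\|}{C}-C .$$ Let $p,q\in[1,\infty)$ with $p<q$. Then there is no coarse map from $J_p$ to $J_q$ that is linearly expanding at rate $1/q$. -/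

import Mathlib

open Filter Topology
open scoped ENNReal

/-! ### Coarse maps and linear expansion at a rate -/

/-- The modulus `ω_f(t) = sup {d(f x, f z) | d(x, z) ≤ t}`, with values in `[0, ∞]`. -/
noncomputable def coarseModulus {X Y : Type*} [MetricSpace X] [MetricSpace Y]
    (f : X → Y) (t : ℝ) : ℝ≥0∞ :=
  ⨆ (x : X) (z : X) (_ : dist x z ≤ t), edist (f x) (f z)

/-- `f` is coarse if `ω_f(t) < ∞` for all `t ≥ 0`. -/
def IsCoarseMap {X Y : Type*} [MetricSpace X] [MetricSpace Y] (f : X → Y) : Prop :=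
  ∀ t : ℝ, 0 ≤ t → coarseModulus f t < ∞

/-- `f` is linearly expanding at rate `α`: for all `L > 0` there is `C > 0` such that
`‖x - z‖ ≥ L max{‖x‖^α, ‖z‖^α} + L` implies `‖f x - f z‖ ≥ ‖x - z‖ / C - C`. -/
def IsLinearlyExpandingAtRate {X Y : Type*} [NormedAddCommGroup X] [NormedSpace ℝ X]
    [NormedAddCommGroup Y] [NormedSpace ℝ Y] (α : ℝ) (f : X → Y) : Prop :=
  ∀ L : ℝ, 0 < L → ∃ C : ℝ, 0 < C ∧ ∀ x z : X,
    L * max (‖x‖ ^ α) (‖z‖ ^ α) + L ≤ ‖x - z‖ → ‖x - z‖ / C - C ≤ ‖f x - f z‖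

/-! ### The James spaces -/

/-- `(∑_{i < n} |x(s(i+1)) - x(s(i))|^p)^{1/p}`. -/
noncomputable def jamesSum (p : ℝ) (x : ℕ → ℝ) (s : ℕ → ℕ) (n : ℕ) : ℝ :=
  (∑ i ∈ Finset.range n, |x (s (i + 1)) - x (s i)| ^ p) ^ (1 / p)

/-- All values of `jamesSum` along finite strictly increasing sequences of indices
(given as the first `n + 1` terms of a strictly increasing sequence). -/
def jamesSums (p : ℝ) (x : ℕ → ℝ) : Set ℝ :=
  {r | ∃ (s : ℕ → ℕ) (n : ℕ), StrictMono s ∧ r = jamesSum p x s n}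

/-- The `p`-variation of `x`, i.e. the James norm (used only when `jamesSums p x` is bounded). -/
noncomputable def jamesNorm (p : ℝ) (x : ℕ → ℝ) : ℝ := sSup (jamesSums p x)

theorem jamesSum_zero (p : ℝ) (hp : 1 ≤ p) (s : ℕ → ℕ) (n : ℕ) :
    jamesSum p (0 : ℕ → ℝ) s n = 0 := by
  have h0 : p ≠ 0 := by linarith
  simp [jamesSum, Real.zero_rpow h0, Real.zero_rpow (inv_ne_zero h0)]

theorem jamesSum_nonneg (p : ℝ) (x : ℕ → ℝ) (s : ℕ → ℕ) (n : ℕ) : 0 ≤ jamesSum p x s n := by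
  unfold jamesSum; positivity

theorem jamesSum_add_le (p : ℝ) (hp : 1 ≤ p) (x y : ℕ → ℝ) (s : ℕ → ℕ) (n : ℕ) :
    jamesSum p (x + y) s n ≤ jamesSum p x s n + jamesSum p y s n := by
  have h := Real.Lp_add_le (Finset.range n) (fun i => x (s (i + 1)) - x (s i))
    (fun i => y (s (i + 1)) - y (s i)) hp
  unfold jamesSum
  refine le_trans (le_of_eq ?_) h
  congr 1
  refine Finset.sum_congr rfl fun i _ => ?_
  congr 2
  simp only [Pi.add_apply]
  ring

theorem jamesSum_smul (p : ℝ) (hp : 1 ≤ p) (c : ℝ) (x : ℕ → ℝ) (s : ℕ → ℕ) (n : ℕ) :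
    jamesSum p (c • x) s n = |c| * jamesSum p x s n := by
  have h0 : p ≠ 0 := by linarith
  have h1 : ∀ i, |(c • x) (s (i + 1)) - (c • x) (s i)| ^ p
      = |c| ^ p * |x (s (i + 1)) - x (s i)| ^ p := fun i => by
    rw [← Real.mul_rpow (abs_nonneg _) (abs_nonneg _), ← abs_mul]
    simp [mul_sub]
  unfold jamesSum
  simp only [h1]
  rw [← Finset.mul_sum, Real.mul_rpow (by positivity) (by positivity), one_div,
    Real.rpow_rpow_inv (abs_nonneg c) h0]

/-- The James space `J_p` as a linear subspace of `ℝ^ℕ`. -/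
def jamesSubmodule (p : ℝ) [hp : Fact (1 ≤ p)] : Submodule ℝ (ℕ → ℝ) where
  carrier := {x | Tendsto x atTop (𝓝 0) ∧ BddAbove (jamesSums p x)}
  zero_mem' := ⟨tendsto_const_nhds, 0, by
    rintro _ ⟨s, n, _, rfl⟩
    exact (jamesSum_zero p hp.out s n).le⟩
  add_mem' := by
    rintro x y ⟨hx, B, hB⟩ ⟨hy, B', hB'⟩
    refine ⟨by simpa [Pi.add_def] using hx.add hy, B + B', ?_⟩
    rintro _ ⟨s, n, hs, rfl⟩
    exact (jamesSum_add_le p hp.out x y s n).trans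
      (add_le_add (hB ⟨s, n, hs, rfl⟩) (hB' ⟨s, n, hs, rfl⟩))
  smul_mem' := by
    rintro c x ⟨hx, B, hB⟩
    refine ⟨by simpa [Pi.smul_def] using hx.const_smul c, |c| * B, ?_⟩
    rintro _ ⟨s, n, hs, rfl⟩
    rw [jamesSum_smul p hp.out]
    exact mul_le_mul_of_nonneg_left (hB ⟨s, n, hs, rfl⟩) (abs_nonneg c)

/-- The real James space `J_p`: sequences tending to `0` with finite `p`-variation. (A type synonym,
so that it carries the topology of its norm and not the one inherited from `ℕ → ℝ`.) -/
def JamesSpace (p : ℝ) [Fact (1 ≤ p)] : Type := ↥(jamesSubmodule p)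

namespace JamesSpace

variable {p : ℝ} [hp : Fact (1 ≤ p)]

noncomputable instance : AddCommGroup (JamesSpace p) :=
  inferInstanceAs (AddCommGroup ↥(jamesSubmodule p))

noncomputable instance : Module ℝ (JamesSpace p) :=
  inferInstanceAs (Module ℝ ↥(jamesSubmodule p))

/-- The underlying sequence. -/
def seq (x : JamesSpace p) : ℕ → ℝ := Subtype.val x

noncomputable instance : Norm (JamesSpace p) := ⟨fun x => jamesNorm p x.seq⟩

theorem norm_def (x : JamesSpace p) : ‖x‖ = sSup (jamesSums p x.seq) := rfl

theorem jamesSum_le_norm (x : JamesSpace p) {s : ℕ → ℕ} (hs : StrictMono s) (n : ℕ) :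
    jamesSum p x.seq s n ≤ ‖x‖ :=
  le_csSup (Subtype.property x).2 ⟨s, n, hs, rfl⟩

theorem norm_le_of_forall (x : JamesSpace p) {B : ℝ}
    (h : ∀ s : ℕ → ℕ, StrictMono s → ∀ n, jamesSum p x.seq s n ≤ B) : ‖x‖ ≤ B := by
  refine csSup_le ⟨_, id, 0, strictMono_id, rfl⟩ ?_
  rintro _ ⟨s, n, hs, rfl⟩
  exact h s hs n

theorem norm_nonneg' (x : JamesSpace p) : 0 ≤ ‖x‖ :=
  (jamesSum_nonneg p x.seq id 0).trans (x.jamesSum_le_norm strictMono_id 0)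

theorem norm_smul_le' (c : ℝ) (x : JamesSpace p) : ‖c • x‖ ≤ |c| * ‖x‖ := by
  refine norm_le_of_forall _ fun s hs n => ?_
  exact (jamesSum_smul p hp.out c x.seq s n).le.trans
    (mul_le_mul_of_nonneg_left (x.jamesSum_le_norm hs n) (abs_nonneg c))

theorem norm_smul' (c : ℝ) (x : JamesSpace p) : ‖c • x‖ = |c| * ‖x‖ := by
  refine le_antisymm (norm_smul_le' c x) ?_
  rcases eq_or_ne c 0 with rfl | hc
  · simpa using norm_nonneg' ((0 : ℝ) • x)
  · have h := norm_smul_le' c⁻¹ (c • x)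
    rw [smul_smul, inv_mul_cancel₀ hc, one_smul, abs_inv] at h
    have hc' : 0 < |c| := abs_pos.mpr hc
    calc |c| * ‖x‖ ≤ |c| * (|c|⁻¹ * ‖c • x‖) := mul_le_mul_of_nonneg_left h hc'.le
      _ = ‖c • x‖ := by rw [← mul_assoc, mul_inv_cancel₀ hc'.ne', one_mul]

theorem norm_add_le' (x y : JamesSpace p) : ‖x + y‖ ≤ ‖x‖ + ‖y‖ := by
  refine norm_le_of_forall _ fun s hs n => ?_
  exact (jamesSum_add_le p hp.out x.seq y.seq s n).trans
    (add_le_add (x.jamesSum_le_norm hs n) (y.jamesSum_le_norm hs n))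

theorem abs_sub_le_norm (x : JamesSpace p) {a b : ℕ} (hab : a < b) :
    |x.seq b - x.seq a| ≤ ‖x‖ := by
  have h0 : p ≠ 0 := by linarith [hp.out]
  have hs : StrictMono (fun i : ℕ => a + (b - a) * i) := fun i j hij =>
    Nat.add_lt_add_left (Nat.mul_lt_mul_of_pos_left hij (Nat.sub_pos_of_lt hab)) a
  have h := x.jamesSum_le_norm hs 1
  have hb : a + (b - a) = b := by omega
  simp only [jamesSum, Finset.sum_range_one, zero_add, mul_one, mul_zero, add_zero, hb] at h
  rwa [one_div, Real.rpow_rpow_inv (abs_nonneg _) h0] at h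

theorem eq_zero_of_norm_eq_zero (x : JamesSpace p) (hx : ‖x‖ = 0) : x = 0 := by
  refine Subtype.ext (funext fun a => ?_)
  have hlim : Tendsto x.seq atTop (𝓝 0) := (Subtype.property x).1
  have hev : x.seq =ᶠ[atTop] fun _ => x.seq a := by
    filter_upwards [eventually_gt_atTop a] with b hb
    have h := (x.abs_sub_le_norm hb).trans hx.le
    exact sub_eq_zero.mp (abs_nonpos_iff.mp h)
  exact tendsto_nhds_unique (tendsto_const_nhds.congr' hev.symm) hlim

theorem normedSpaceCore : NormedSpace.Core ℝ (JamesSpace p) where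
  norm_nonneg := norm_nonneg'
  norm_smul := norm_smul'
  norm_triangle := norm_add_le'
  norm_eq_zero_iff x := ⟨eq_zero_of_norm_eq_zero x, by
    rintro rfl
    simpa using norm_smul' (0 : ℝ) (0 : JamesSpace p)⟩

noncomputable instance : NormedAddCommGroup (JamesSpace p) :=
  NormedAddCommGroup.ofCore normedSpaceCore

noncomputable instance : NormedSpace ℝ (JamesSpace p) :=
  NormedSpace.ofCore normedSpaceCore

end JamesSpace

/-! Interlace two sums of unit vectors of `J_p`: x = e_{n₁} + ⋯ + e_{n_k} and z = e_{m₁} + ⋯ +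
e_{m_k} with n₁ < m₁ < n₂ < m₂ < ⋯. Both have norm at most 2k, while x - z drops from 1 to -1 on k
disjoint intervals, so ‖x - z‖ ≥ k^{1/p}. If f is bounded by K at scale 2, the indices can be chosen
so that ‖f x - f z‖ = O(k^{1/q}) (`exists_interlaced_norm_le`). As k^{1/p} outgrows both k^{1/q} and
the expansion threshold (2k)^{1/q} + 1, expansion at rate 1/q fails.

For the upper estimate, let F_r be the r-fold coordinatewise limit of f along translations by unit
vectors. Then f x - f z telescopes into k increments D = (F_r(x + e_n) - F_{r+1}(x)) - (F_r(z + e_m)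
- F_{r+1}(z)), each of q-variation at most 4K. Suitable n, m make D small on any given initial
segment. Coordinatewise limits need not vanish at infinity, so the limits at infinity at x and z are
also kept close. Hence D is, up to a small error, a block supported beyond the earlier ones, and k
successive blocks have q-variation O(k^{1/q}) (`IsControl.append_block`). The choice of indices is
the induction `exists_interlaced`. -/

/-! ### Variation bounds and control functions -/

/-- The `q`-variation of `x` is at most `K`. -/
def VarLe (q : ℝ) (x : ℕ → ℝ) (K : ℝ) : Prop :=
  ∀ s : ℕ → ℕ, StrictMono s → ∀ n, jamesSum q x s n ≤ K

/-- `V` takes values in `[0, A]` and controls the `q`-th powers of the increments of `x`. -/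
def IsControl (q : ℝ) (x V : ℕ → ℝ) (A : ℝ) : Prop :=
  (∀ t, 0 ≤ V t ∧ V t ≤ A) ∧ ∀ u t, u < t → |x t - x u| ^ q ≤ V t - V u

theorem jamesSum_le_iff {q : ℝ} (hq : 1 ≤ q) (x : ℕ → ℝ) (s : ℕ → ℕ) (n : ℕ) {K : ℝ}
    (hK : 0 ≤ K) : jamesSum q x s n ≤ K ↔
      ∑ i ∈ Finset.range n, |x (s (i + 1)) - x (s i)| ^ q ≤ K ^ q := by
  have hq0 : 0 < q := by linarith
  unfold jamesSum
  rw [one_div, Real.rpow_inv_le_iff_of_pos (Finset.sum_nonneg fun i _ => by positivity) hK hq0]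

theorem IsControl.mono {q : ℝ} {x V : ℕ → ℝ} {A : ℝ} (h : IsControl q x V A) : Monotone V := by
  refine monotone_nat_of_le_succ fun n => ?_
  have h1 := h.2 n (n + 1) n.lt_succ_self
  have h2 : 0 ≤ |x (n + 1) - x n| ^ q := by positivity
  linarith

theorem IsControl.varLe {q : ℝ} (hq : 1 ≤ q) {x V : ℕ → ℝ} {K : ℝ} (hK : 0 ≤ K)
    (h : IsControl q x V (K ^ q)) : VarLe q x K := by
  intro s hs n
  rw [jamesSum_le_iff hq x s n hK]
  calc ∑ i ∈ Finset.range n, |x (s (i + 1)) - x (s i)| ^ q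
      ≤ ∑ i ∈ Finset.range n, (V (s (i + 1)) - V (s i)) :=
        Finset.sum_le_sum fun i _ => h.2 _ _ (hs i.lt_succ_self)
    _ = V (s n) - V (s 0) := Finset.sum_range_sub (fun i => V (s i)) n
    _ ≤ K ^ q := by linarith [(h.1 (s n)).2, (h.1 (s 0)).1]

/-- The control at t is the supremum of the q-th power sums over chains ending at t; a chain ending
at u < t can be prolonged by t. -/
theorem VarLe.exists_control {q : ℝ} (hq : 1 ≤ q) {x : ℕ → ℝ} {K : ℝ} (hK : 0 ≤ K)
    (h : VarLe q x K) : ∃ V, IsControl q x V (K ^ q) := by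
  let S : ℕ → Set ℝ := fun t => {r | ∃ (s : ℕ → ℕ) (n : ℕ), StrictMono s ∧ s n = t ∧
    r = ∑ i ∈ Finset.range n, |x (s (i + 1)) - x (s i)| ^ q}
  have hub : ∀ t, ∀ r ∈ S t, r ≤ K ^ q := by
    rintro t _ ⟨s, n, hs, -, rfl⟩
    exact (jamesSum_le_iff hq x s n hK).1 (h s hs n)
  have h0 : ∀ t, (0 : ℝ) ∈ S t := fun t =>
    ⟨fun i => t + i, 0, fun i j hij => by simpa using hij, by simp, by simp⟩
  have hbdd : ∀ t, BddAbove (S t) := fun t => ⟨K ^ q, hub t⟩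
  refine ⟨fun t => sSup (S t), fun t => ⟨le_csSup (hbdd t) (h0 t),
    csSup_le ⟨0, h0 t⟩ (hub t)⟩, fun u t hut => ?_⟩
  rw [le_sub_iff_add_le', ← le_sub_iff_add_le]
  refine csSup_le ⟨0, h0 u⟩ ?_
  rintro _ ⟨s, n, hs, hsn, rfl⟩
  rw [le_sub_iff_add_le]
  -- The chain s up to index n, then t, t + 1, …; only the first step, from u to t, enters the sum.
  refine le_csSup (hbdd t) ⟨fun i => if i ≤ n then s i else t + (i - n - 1), n + 1, ?_, ?_, ?_⟩
  · refine strictMono_nat_of_lt_succ fun i => ?_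
    have := hs i.lt_succ_self
    by_cases h1 : i + 1 ≤ n
    · simp only [h1, (by omega : i ≤ n), if_true]; exact this
    · by_cases h2 : i = n
      · subst h2; simp [hsn, hut]
      · rw [if_neg (by omega), if_neg h1]; omega
  · simp
  · rw [Finset.sum_range_succ]
    congr 1
    · refine Finset.sum_congr rfl fun i hi => ?_
      have := Finset.mem_range.1 hi
      simp [(by omega : i + 1 ≤ n), (by omega : i ≤ n)]
    · simp [hsn]

theorem VarLe.nonneg {q : ℝ} {x : ℕ → ℝ} {K : ℝ} (h : VarLe q x K) : 0 ≤ K :=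
  (jamesSum_nonneg q x id 0).trans (h id strictMono_id 0)

theorem VarLe.add {q : ℝ} (hq : 1 ≤ q) {x y : ℕ → ℝ} {A B : ℝ} (hx : VarLe q x A)
    (hy : VarLe q y B) : VarLe q (x + y) (A + B) := fun s hs n =>
  (jamesSum_add_le q hq x y s n).trans (add_le_add (hx s hs n) (hy s hs n))

theorem VarLe.neg {q : ℝ} {x : ℕ → ℝ} {A : ℝ} (hx : VarLe q x A) : VarLe q (-x) A := by
  intro s hs n
  refine le_of_eq_of_le ?_ (hx s hs n)
  unfold jamesSum
  congr 1
  refine Finset.sum_congr rfl fun i _ => ?_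
  rw [Pi.neg_apply, Pi.neg_apply, ← abs_neg]
  congr 2
  ring

theorem VarLe.sub {q : ℝ} (hq : 1 ≤ q) {x y : ℕ → ℝ} {A B : ℝ} (hx : VarLe q x A)
    (hy : VarLe q y B) : VarLe q (x - y) (A + B) := by
  rw [sub_eq_add_neg]; exact hx.add hq hy.neg

theorem varLe_of_tendsto {ι : Type*} {l : Filter ι} [NeBot l] {q : ℝ} (hq : 1 ≤ q)
    {X : ι → ℕ → ℝ} {x : ℕ → ℝ} {K : ℝ} (hX : ∀ i, VarLe q (X i) K)
    (hlim : ∀ t, Tendsto (fun i => X i t) l (𝓝 (x t))) : VarLe q x K := by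
  intro s hs n
  have hq0 : 0 ≤ q := by linarith
  refine le_of_tendsto (x := l) (f := fun i => jamesSum q (X i) s n) ?_
    (Eventually.of_forall fun i => hX i s hs n)
  unfold jamesSum
  refine Tendsto.rpow_const ?_ (Or.inr (by positivity))
  exact tendsto_finsetSum _ fun i _ =>
    (((hlim _).sub (hlim _)).abs).rpow_const (Or.inr hq0)

/-- A control is monotone and bounded, so its increments, and with them those of x, are Cauchy. -/
theorem VarLe.exists_tendsto {q : ℝ} (hq : 1 ≤ q) {x : ℕ → ℝ} {K : ℝ} (h : VarLe q x K) :
    ∃ c, Tendsto x atTop (𝓝 c) := by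
  have hq0 : 0 < q := by linarith
  obtain ⟨V, hV⟩ := h.exists_control hq h.nonneg
  have hbdd : BddAbove (Set.range V) := ⟨K ^ q, by rintro _ ⟨t, rfl⟩; exact (hV.1 t).2⟩
  have hlim := tendsto_atTop_ciSup hV.mono hbdd
  refine cauchySeq_tendsto_of_complete (cauchySeq_of_le_tendsto_0'
    (fun n => ((⨆ i, V i) - V n) ^ q⁻¹) (fun n m hnm => ?_) ?_)
  · have h1 : 0 ≤ (⨆ i, V i) - V n := sub_nonneg.2 (le_ciSup hbdd n)
    rw [dist_comm, Real.dist_eq, Real.le_rpow_inv_iff_of_pos (abs_nonneg _) h1 hq0]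
    rcases hnm.eq_or_lt with rfl | hlt
    · simpa [Real.zero_rpow hq0.ne'] using h1
    · exact (hV.2 n m hlt).trans (sub_le_sub_right (le_ciSup hbdd m) _)
  · have h2 : Tendsto (fun n => (⨆ i, V i) - V n) atTop (𝓝 0) := by
      simpa using hlim.const_sub (⨆ i, V i)
    simpa [Real.zero_rpow (inv_ne_zero hq0.ne')] using
      h2.rpow_const (p := q⁻¹) (Or.inr (by positivity))

/-! ### Truncation -/

theorem varLe_truncate_init {q : ℝ} (hq : 1 ≤ q) {x : ℕ → ℝ} {T : ℕ} {δ η : ℝ} (hδ : 0 ≤ δ)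
    (hη : 0 ≤ η) (hx : ∀ t ≤ T, |x t| ≤ δ) (hδη : (2 * δ) ^ q * (T + 1) ≤ η ^ q) :
    VarLe q (fun t => if t ≤ T then x t else 0) η := by
  have hq0 : q ≠ 0 := by linarith
  have hpos : 0 ≤ (2 * δ) ^ q := by positivity
  refine IsControl.varLe hq hη (V := fun t => (2 * δ) ^ q * (min t (T + 1) : ℕ))
    ⟨fun t => ⟨by positivity, le_trans ?_ hδη⟩, fun u t hut => ?_⟩
  · refine mul_le_mul_of_nonneg_left ?_ hpos
    exact_mod_cast min_le_right t (T + 1)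
  · have hb : ∀ t, |if t ≤ T then x t else 0| ≤ δ := fun t => by
      split_ifs with h
      · exact hx t h
      · simpa using hδ
    by_cases hu : u ≤ T
    · have h1 : ((min u (T + 1) : ℕ) : ℝ) + 1 ≤ (min t (T + 1) : ℕ) := by
        have : min u (T + 1) + 1 ≤ min t (T + 1) := by omega
        exact_mod_cast this
      calc _ ≤ (2 * δ) ^ q := by
            refine Real.rpow_le_rpow (abs_nonneg _) ?_ (by linarith)
            exact (abs_sub _ _).trans (by linarith [hb t, hb u])
        _ ≤ (2 * δ) ^ q * ((min t (T + 1) : ℕ) - (min u (T + 1) : ℕ)) :=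
            le_mul_of_one_le_right hpos (by linarith)
        _ = _ := by ring
    · have h1 : min u (T + 1) = T + 1 := by omega
      have h2 : min t (T + 1) = T + 1 := by omega
      have h3 : ¬ t ≤ T := by omega
      simp only [hu, h3, if_false, h1, h2, sub_self, abs_zero, Real.zero_rpow hq0, le_refl]

theorem exists_varLe_truncate_tail {q : ℝ} (hq : 1 ≤ q) {x : ℕ → ℝ} {K c η : ℝ}
    (hx : VarLe q x K) (hc : Tendsto x atTop (𝓝 c)) (hcη : |c| < η / 2) (T : ℕ) :
    ∃ T' ≥ T, VarLe q (fun t => if t ≤ T' then 0 else x t) η := by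
  have hη : 0 < η / 2 := (abs_nonneg c).trans_lt hcη
  have hq0 : 0 < q := by linarith
  obtain ⟨V, hV⟩ := hx.exists_control hq hx.nonneg
  have hbdd : BddAbove (Set.range V) := ⟨K ^ q, by rintro _ ⟨t, rfl⟩; exact (hV.1 t).2⟩
  have hlim := tendsto_atTop_ciSup hV.mono hbdd
  have hηq : 0 < (η / 2) ^ q := by positivity
  have e1 : ∀ᶠ T' in atTop, ∀ t ≥ T', |x t| < η / 2 :=
    eventually_forall_ge_atTop.2 (hc.abs.eventually_lt_const hcη)
  have e2 : ∀ᶠ T' in atTop, (⨆ i, V i) - (η / 2) ^ q < V T' :=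
    hlim.eventually_const_lt (by linarith)
  obtain ⟨T', h1, h2, h3⟩ := (e1.and (e2.and (eventually_ge_atTop T))).exists
  -- Half of the budget 2(η/2)^q ≤ η^q pays for the jump at T', half for the remaining variation of
  -- x.
  refine ⟨T', h3, IsControl.varLe hq (by linarith)
    (V := fun t => if t ≤ T' then 0 else (η / 2) ^ q + (V t - V T')) ⟨fun t => ?_, fun u t hut => ?_⟩⟩
  · have h4 : 2 * (η / 2) ^ q ≤ η ^ q := by
      have h5 : η ^ q = 2 ^ q * (η / 2) ^ q := by
        rw [← Real.mul_rpow (by norm_num) hη.le]; congr 1; ring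
      rw [h5]
      gcongr
      simpa using Real.rpow_le_rpow_of_exponent_le (one_le_two (α := ℝ)) hq
    dsimp only
    split_ifs with h
    · exact ⟨le_rfl, by linarith⟩
    · have h5 := hV.mono (le_of_not_ge h)
      have h6 := le_ciSup hbdd t
      exact ⟨by linarith, by linarith⟩
  · by_cases ht : t ≤ T'
    · simp [ht, hut.le.trans ht, Real.zero_rpow hq0.ne']
    · by_cases hu : u ≤ T'
      · have h5 := hV.mono (le_of_not_ge ht)
        have h6 : |x t| ^ q ≤ (η / 2) ^ q :=
          Real.rpow_le_rpow (abs_nonneg _) (h1 t (le_of_not_ge ht)).le hq0.le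
        simp only [ht, hu, if_true, if_false, sub_zero]
        linarith
      · simp only [ht, hu, if_false]
        linarith [hV.2 u t hut]

/-- The q-th power of the variation grows only additively: (2M)^q for the jump into the block, at
most (2M)^q inside it, (2M)^q for the jump out. -/
theorem IsControl.append_block {q : ℝ} (hq : 1 ≤ q) {y W x V : ℕ → ℝ} {A M : ℝ} {T T' : ℕ}
    (hy : IsControl q y W A) (hyM : ∀ t, |y t| ≤ M)
    (hx : IsControl q x V (M ^ q)) (hxM : ∀ t, |x t| ≤ M) :
    ∃ U, IsControl q (fun t => if t ≤ T then y t else if t ≤ T' then x t else 0) U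
      (A + 3 * (2 * M) ^ q) := by
  have hM : 0 ≤ M := (abs_nonneg _).trans (hyM 0)
  have hq0 : 0 < q := by linarith
  have hMq : M ^ q ≤ (2 * M) ^ q := Real.rpow_le_rpow hM (by linarith) hq0.le
  have hM0 : 0 ≤ M ^ q := by positivity
  have hdiff : ∀ a b : ℝ, |a| ≤ M → |b| ≤ M → |a - b| ^ q ≤ (2 * M) ^ q := fun a b ha hb =>
    Real.rpow_le_rpow (abs_nonneg _) ((abs_sub a b).trans (by linarith)) hq0.le
  have h0 : |(0 : ℝ)| ≤ M := by simpa using hM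
  refine ⟨fun t => if t ≤ T then W t else if t ≤ T' then A + (2 * M) ^ q + V t
    else A + 3 * (2 * M) ^ q, fun t => ?_, fun u t hut => ?_⟩
  · have h1 := hy.1 t
    have h2 := hx.1 t
    dsimp only
    split_ifs <;> constructor <;> linarith
  · have h1 := hy.1 u
    have h2 := hx.1 t
    have h3 := hx.1 u
    dsimp only
    by_cases ht : t ≤ T
    · simp only [ht, hut.le.trans ht, if_true]
      exact hy.2 u t hut
    · by_cases hu : u ≤ T
      · by_cases ht' : t ≤ T'
        · simp only [ht, hu, ht', if_true, if_false]
          linarith [hdiff _ _ (hxM t) (hyM u)]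
        · simp only [ht, hu, ht', if_true, if_false]
          linarith [hdiff _ _ h0 (hyM u)]
      · by_cases ht' : t ≤ T'
        · simp only [ht, hu, ht', hut.le.trans ht', if_true, if_false]
          linarith [hx.2 u t hut]
        · by_cases hu' : u ≤ T'
          · simp only [ht, hu, ht', hu', if_true, if_false]
            linarith [hdiff _ _ h0 (hxM u)]
          · simp [ht, hu, ht', hu', Real.zero_rpow hq0.ne']

/-! ### Limits along translations -/

section ShiftLim

variable {E : Type*} [NormedAddCommGroup E]

/-- The limit of `φ (x + e n)` along a nonprincipal ultrafilter. -/
noncomputable def shiftLim (e : ℕ → E) (φ : E → ℝ) (x : E) : ℝ :=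
  limUnder (hyperfilter ℕ : Filter ℕ) fun n => φ (x + e n)

/-- `φ` varies by at most `K` on sets of diameter at most `2`. -/
def OscLe (φ : E → ℝ) (K : ℝ) : Prop := ∀ x y, ‖x - y‖ ≤ 2 → |φ x - φ y| ≤ K

variable {e : ℕ → E} {φ : E → ℝ} {K : ℝ}

theorem OscLe.tendsto_shiftLim (he : ∀ n, ‖e n‖ ≤ 2) (h : OscLe φ K) (x : E) :
    Tendsto (fun n => φ (x + e n)) (hyperfilter ℕ : Filter ℕ) (𝓝 (shiftLim e φ x)) := by
  refine tendsto_nhds_limUnder ?_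
  have hmem : ∀ n, φ (x + e n) ∈ Set.Icc (φ x - K) (φ x + K) := fun n => by
    have := abs_le.1 (h (x + e n) x (by simpa using he n))
    exact ⟨by linarith, by linarith⟩
  obtain ⟨a, -, ha⟩ := isCompact_Icc.ultrafilter_le_nhds'
    ((hyperfilter ℕ).map fun n => φ (x + e n))
    (Ultrafilter.mem_map.2 (Filter.univ_mem' hmem))
  exact ⟨a, ha⟩

theorem OscLe.shiftLim (he : ∀ n, ‖e n‖ ≤ 2) (h : OscLe φ K) : OscLe (shiftLim e φ) K :=
  fun x y hxy => le_of_tendsto ((h.tendsto_shiftLim he x).sub (h.tendsto_shiftLim he y)).abs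
    (Eventually.of_forall fun n => h _ _ (by simpa using hxy))

theorem OscLe.iterate_shiftLim (he : ∀ n, ‖e n‖ ≤ 2) (h : OscLe φ K) (r : ℕ) :
    OscLe ((_root_.shiftLim e)^[r] φ) K := by
  induction r with
  | zero => exact h
  | succ r ih => rw [Function.iterate_succ_apply']; exact ih.shiftLim he

theorem OscLe.tendsto_iterate (he : ∀ n, ‖e n‖ ≤ 2) (h : OscLe φ K) (r : ℕ) (x : E) :
    Tendsto (fun n => (_root_.shiftLim e)^[r] φ (x + e n)) (hyperfilter ℕ : Filter ℕ)
      (𝓝 ((_root_.shiftLim e)^[r + 1] φ x)) := by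
  rw [Function.iterate_succ_apply']
  exact (h.iterate_shiftLim he r).tendsto_shiftLim he x

end ShiftLim

/-! ### Coordinates and unit vectors of the James space -/

namespace JamesSpace

theorem abs_seq_le_norm {q : ℝ} [Fact (1 ≤ q)] (x : JamesSpace q) (t : ℕ) : |x.seq t| ≤ ‖x‖ := by
  have hlim : Tendsto x.seq atTop (𝓝 0) := (Subtype.property x).1
  have h := (hlim.sub_const (x.seq t)).abs
  rw [zero_sub, abs_neg] at h
  refine le_of_tendsto h ?_
  filter_upwards [eventually_gt_atTop t] with b hb using x.abs_sub_le_norm hb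

theorem varLe_norm {q : ℝ} [Fact (1 ≤ q)] (x : JamesSpace q) : VarLe q x.seq ‖x‖ :=
  fun _ hs n => x.jamesSum_le_norm hs n

theorem varLe_single {p : ℝ} (hp : 1 ≤ p) (n : ℕ) : VarLe p (Pi.single n (1 : ℝ)) 2 := by
  have hp0 : p ≠ 0 := by linarith
  refine IsControl.varLe hp (by norm_num)
    (V := fun t => if t < n then 0 else if t = n then 1 else 2) ⟨fun t => ?_, fun u t hut => ?_⟩
  · have h2 : (2 : ℝ) ≤ 2 ^ p := by
      simpa using Real.rpow_le_rpow_of_exponent_le (one_le_two (α := ℝ)) hp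
    dsimp only
    split_ifs <;> constructor <;> linarith
  · simp only [Pi.single_apply]
    rcases lt_trichotomy t n with h | h | h
    · simp [h, h.ne, hut.trans h, (hut.trans h).ne, Real.zero_rpow hp0]
    · subst h; simp [hut, hut.ne]
    · rcases lt_trichotomy u n with h' | h' | h'
      · simp [h.ne', h.not_gt, h', h'.ne, Real.zero_rpow hp0]
      · subst h'; simp [h.ne', h.not_gt]; norm_num
      · simp [h.ne', h.not_gt, h'.not_gt, h'.ne', Real.zero_rpow hp0]

/-- The unit vectors of `J_p`. -/
noncomputable def unitVec (p : ℝ) [hp : Fact (1 ≤ p)] (n : ℕ) : JamesSpace p :=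
  ⟨Pi.single n 1, by
    refine tendsto_const_nhds.congr' ?_
    filter_upwards [eventually_gt_atTop n] with t ht
    simp [ht.ne'], 2, by
    rintro _ ⟨s, m, hs, rfl⟩
    exact varLe_single hp.out n s hs m⟩

theorem norm_unitVec_le (p : ℝ) [hp : Fact (1 ≤ p)] (n : ℕ) : ‖unitVec p n‖ ≤ 2 :=
  norm_le_of_forall _ fun s hs m => varLe_single hp.out n s hs m

end JamesSpace

/-! ### Iterated weak limits of maps into `J_q` -/

section IterLim

variable {E : Type*} [NormedAddCommGroup E] {q : ℝ} [hq : Fact (1 ≤ q)]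

/-- The `r`-fold iterated coordinatewise limit of `f (x + e n₁ + ⋯ + e nᵣ)`. -/
noncomputable def iterLim (e : ℕ → E) (f : E → JamesSpace q) (r : ℕ) (x : E) (t : ℕ) : ℝ :=
  (shiftLim e)^[r] (fun y => (f y).seq t) x

/-- The limit at infinity of the sequence `iterLim e f r x`. -/
noncomputable def iterLimTop (e : ℕ → E) (f : E → JamesSpace q) (r : ℕ) (x : E) : ℝ :=
  limUnder atTop (iterLim e f r x)

variable {e : ℕ → E} {f : E → JamesSpace q} {K : ℝ}

theorem oscLe_seq (hf : ∀ x y, ‖x - y‖ ≤ 2 → ‖f x - f y‖ ≤ K) (t : ℕ) :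
    OscLe (fun y => (f y).seq t) K := fun x y hxy =>
  ((f x - f y).abs_seq_le_norm t).trans (hf x y hxy)

theorem oscLe_iterLim (he : ∀ n, ‖e n‖ ≤ 2) (hf : ∀ x y, ‖x - y‖ ≤ 2 → ‖f x - f y‖ ≤ K)
    (r t : ℕ) : OscLe (fun y => iterLim e f r y t) K :=
  (oscLe_seq hf t).iterate_shiftLim he r

theorem tendsto_iterLim (he : ∀ n, ‖e n‖ ≤ 2) (hf : ∀ x y, ‖x - y‖ ≤ 2 → ‖f x - f y‖ ≤ K)
    (r : ℕ) (x : E) (t : ℕ) : Tendsto (fun n => iterLim e f r (x + e n) t)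
      (hyperfilter ℕ : Filter ℕ) (𝓝 (iterLim e f (r + 1) x t)) :=
  (oscLe_seq hf t).tendsto_iterate he r x

theorem varLe_iterLim_sub (he : ∀ n, ‖e n‖ ≤ 2) (hf : ∀ x y, ‖x - y‖ ≤ 2 → ‖f x - f y‖ ≤ K)
    (r : ℕ) : ∀ x y, ‖x - y‖ ≤ 2 → VarLe q (iterLim e f r x - iterLim e f r y) K := by
  induction r with
  | zero => exact fun x y hxy s hs n => ((f x - f y).varLe_norm s hs n).trans (hf x y hxy)
  | succ r ih =>
    intro x y hxy
    exact varLe_of_tendsto hq.out (fun n => ih (x + e n) (y + e n) (by simpa using hxy))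
      fun t => (tendsto_iterLim he hf r x t).sub (tendsto_iterLim he hf r y t)

/-- Both terms lie within K of `iterLim e f r x`, the second by lower semicontinuity of the
variation. -/
theorem varLe_iterLim_step (he : ∀ n, ‖e n‖ ≤ 2) (hf : ∀ x y, ‖x - y‖ ≤ 2 → ‖f x - f y‖ ≤ K)
    (r : ℕ) (x : E) (n : ℕ) : VarLe q (iterLim e f r (x + e n) - iterLim e f (r + 1) x) (2 * K) := by
  have h1 : VarLe q (iterLim e f r (x + e n) - iterLim e f r x) K :=
    varLe_iterLim_sub he hf r _ _ (by simpa using he n)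
  have h2 : VarLe q (iterLim e f r x - iterLim e f (r + 1) x) K :=
    varLe_of_tendsto hq.out (fun m => varLe_iterLim_sub he hf r x (x + e m) (by simpa using he m))
      fun t => (tendsto_iterLim he hf r x t).const_sub _
  have h3 := h1.add hq.out h2
  rwa [sub_add_sub_cancel, ← two_mul] at h3

theorem abs_iterLim_step (he : ∀ n, ‖e n‖ ≤ 2) (hf : ∀ x y, ‖x - y‖ ≤ 2 → ‖f x - f y‖ ≤ K)
    (r : ℕ) (x : E) (n t : ℕ) : |iterLim e f r (x + e n) t - iterLim e f (r + 1) x t| ≤ 2 * K := by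
  have h1 := oscLe_iterLim he hf r t (x + e n) x (by simpa using he n)
  have h2 : |iterLim e f r x t - iterLim e f (r + 1) x t| ≤ K :=
    le_of_tendsto ((tendsto_iterLim he hf r x t).const_sub _).abs
      (Eventually.of_forall fun m => oscLe_iterLim he hf r t x (x + e m) (by simpa using he m))
  have h3 := abs_sub_le (iterLim e f r (x + e n) t) (iterLim e f r x t) (iterLim e f (r + 1) x t)
  dsimp only at h1
  linarith

theorem varLe_iterLim (he : ∀ n, ‖e n‖ ≤ 2) (hf : ∀ x y, ‖x - y‖ ≤ 2 → ‖f x - f y‖ ≤ K)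
    (r : ℕ) (x : E) : ∃ B, VarLe q (iterLim e f r x) B := by
  induction r with
  | zero => exact ⟨‖f x‖, (f x).varLe_norm⟩
  | succ r ih =>
    obtain ⟨B, hB⟩ := ih
    have h := hB.add hq.out (varLe_of_tendsto hq.out (l := (hyperfilter ℕ : Filter ℕ))
      (fun m => varLe_iterLim_sub he hf r (x + e m) x (by simpa using he m))
      fun t => (tendsto_iterLim he hf r x t).sub_const _)
    refine ⟨B + K, ?_⟩
    convert h using 1
    ext t
    simp

theorem tendsto_iterLimTop (he : ∀ n, ‖e n‖ ≤ 2)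
    (hf : ∀ x y, ‖x - y‖ ≤ 2 → ‖f x - f y‖ ≤ K) (r : ℕ) (x : E) :
    Tendsto (iterLim e f r x) atTop (𝓝 (iterLimTop e f r x)) :=
  tendsto_nhds_limUnder <| (varLe_iterLim he hf r x).elim fun _ hB => hB.exists_tendsto hq.out

theorem oscLe_iterLimTop (he : ∀ n, ‖e n‖ ≤ 2)
    (hf : ∀ x y, ‖x - y‖ ≤ 2 → ‖f x - f y‖ ≤ K) (r : ℕ) : OscLe (iterLimTop e f r) K :=
  fun x y hxy => le_of_tendsto
    ((tendsto_iterLimTop he hf r x).sub (tendsto_iterLimTop he hf r y)).abs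
    (Eventually.of_forall fun t => oscLe_iterLim he hf r t x y hxy)

/-- A translate `x + e n` along which the iterated limits have nearly converged. -/
theorem exists_translate (he : ∀ n, ‖e n‖ ≤ 2)
    (hf : ∀ x y, ‖x - y‖ ≤ 2 → ‖f x - f y‖ ≤ K) (r : ℕ) (x : E) (N T : ℕ) {δ ε : ℝ}
    (hδ : 0 < δ) (hε : 0 < ε) : ∃ n > N,
      (∀ t ≤ T, |iterLim e f r (x + e n) t - iterLim e f (r + 1) x t| ≤ δ) ∧
      ∀ a j, a + j = r → |(shiftLim e)^[a] (iterLimTop e f j) (x + e n) -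
        (shiftLim e)^[a + 1] (iterLimTop e f j) x| ≤ ε := by
  have close : ∀ {u : ℕ → ℝ} {c η : ℝ}, 0 < η → Tendsto u (hyperfilter ℕ : Filter ℕ) (𝓝 c) →
      ∀ᶠ n in (hyperfilter ℕ : Filter ℕ), |u n - c| ≤ η := fun hη hu => by
    filter_upwards [Metric.tendsto_nhds.1 hu _ hη] with n hn using hn.le
  have h1 : ∀ᶠ n in (hyperfilter ℕ : Filter ℕ), N < n :=
    hyperfilter_le_cofinite (by rw [Nat.cofinite_eq_atTop]; exact eventually_gt_atTop N)
  have h2 : ∀ᶠ n in (hyperfilter ℕ : Filter ℕ), ∀ t ∈ Finset.range (T + 1),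
      |iterLim e f r (x + e n) t - iterLim e f (r + 1) x t| ≤ δ :=
    (eventually_all_finset _).2 fun t _ => close hδ (tendsto_iterLim he hf r x t)
  have h3 : ∀ᶠ n in (hyperfilter ℕ : Filter ℕ), ∀ a ∈ Finset.range (r + 1),
      |(shiftLim e)^[a] (iterLimTop e f (r - a)) (x + e n) -
        (shiftLim e)^[a + 1] (iterLimTop e f (r - a)) x| ≤ ε :=
    (eventually_all_finset _).2 fun a _ =>
      close hε ((oscLe_iterLimTop he hf (r - a)).tendsto_iterate he a x)
  obtain ⟨n, hn1, hn2, hn3⟩ := (h1.and (h2.and h3)).exists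
  refine ⟨n, hn1, fun t ht => hn2 t (Finset.mem_range.2 (by omega)), fun a j haj => ?_⟩
  have h := hn3 a (Finset.mem_range.2 (by omega))
  rwa [(by omega : r - a = j)] at h

end IterLim

/-! ### Interlaced pairs -/

/-- `w` vanishes beyond `N`, and the `p`-th power of its variation on `[0, N]` is at least `i`. -/
def VarGe (p : ℝ) (w : ℕ → ℝ) (N : ℕ) (i : ℝ) : Prop :=
  (∀ t > N, w t = 0) ∧ ∀ V : ℕ → ℝ,
    (∀ u t, u < t → t ≤ N → |w t - w u| ^ p ≤ V t - V u) → V 0 + i ≤ V N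

theorem VarGe.add_single_sub_single {p : ℝ} (hp : 1 ≤ p) {w : ℕ → ℝ} {N n m : ℕ} {i : ℝ}
    (h : VarGe p w N i) (hn : N < n) (hm : n < m) :
    VarGe p (w + (Pi.single n 1 - Pi.single m 1)) m (i + 1) := by
  have hw : ∀ t, (w + (Pi.single n 1 - Pi.single m 1) : ℕ → ℝ) t =
      w t + ((if t = n then 1 else 0) - if t = m then 1 else 0) := fun t => by
    simp [Pi.single_apply]
  refine ⟨fun t ht => ?_, fun V hV => ?_⟩
  · rw [hw, h.1 t (by omega), if_neg (by omega), if_neg (by omega)]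
    norm_num
  · simp only [hw] at hV
    have h1 := h.2 V fun u t hut htN => by
      have h2 := hV u t hut (by omega)
      rwa [if_neg (by omega), if_neg (by omega), if_neg (by omega), if_neg (by omega), sub_self,
        add_zero, add_zero] at h2
    have h2 : 0 ≤ V n - V N := le_trans (by positivity) (hV N n hn hm.le)
    have h3 := hV n m hm le_rfl
    rw [h.1 n hn, h.1 m (by omega), if_neg hm.ne', if_pos rfl, if_pos rfl, if_neg hm.ne] at h3
    have h4 : (1 : ℝ) ≤ |0 + (0 - 1) - (0 + (1 - 0))| ^ p :=
      Real.one_le_rpow (by norm_num) (by linarith)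
    linarith

theorem VarGe.le_rpow {p : ℝ} (hp : 1 ≤ p) {w : ℕ → ℝ} {N : ℕ} {i K : ℝ}
    (h : VarGe p w N i) (hK : VarLe p w K) : i ≤ K ^ p := by
  obtain ⟨V, hV⟩ := hK.exists_control hp hK.nonneg
  linarith [h.2 V fun u t hut _ => hV.2 u t hut, (hV.1 0).1, (hV.1 N).2]

/-- After i of the k indices are chosen, r limits remain. The difference of the limits is y, made of
blocks inside [0, T], plus an error w. The limit at infinity need not commute with `shiftLim`, so
for every j ≤ r the function `iterLimTop e f j` is tracked through its own a = r - j remaining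
limits; it is needed bare (a = 0) when r reaches j. -/
theorem exists_interlaced {p q : ℝ} [hp : Fact (1 ≤ p)] [hq : Fact (1 ≤ q)]
    {f : JamesSpace p → JamesSpace q} {K : ℝ} (hK : 0 ≤ K)
    (hf : ∀ x y, ‖x - y‖ ≤ 2 → ‖f x - f y‖ ≤ K) {ε η : ℝ} (hε : 0 < ε) (hη : 0 < η)
    (k : ℕ) (hεη : (2 * k + 1) * ε < η / 2) (i r : ℕ) (hir : i + r = k) :
    ∃ (x z : JamesSpace p) (y w W : ℕ → ℝ) (T N : ℕ),
      iterLim (JamesSpace.unitVec p) f r x - iterLim (JamesSpace.unitVec p) f r z = y + w ∧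
      (∀ t > T, y t = 0) ∧ (∀ t, |y t| ≤ 4 * K) ∧
      IsControl q y W (i * (3 * (2 * (4 * K)) ^ q)) ∧ VarLe q w (i * (2 * η)) ∧
      (∀ a j, a + j = r →
        |(shiftLim (JamesSpace.unitVec p))^[a] (iterLimTop (JamesSpace.unitVec p) f j) x -
          (shiftLim (JamesSpace.unitVec p))^[a] (iterLimTop (JamesSpace.unitVec p) f j) z|
          ≤ i * ε) ∧
      ‖x‖ ≤ 2 * i ∧ ‖z‖ ≤ 2 * i ∧ VarGe p (x - z).seq N i := by
  have he := JamesSpace.norm_unitVec_le p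
  have hq0 : q ≠ 0 := by linarith [hq.out]
  induction i generalizing r with
  | zero =>
    refine ⟨0, 0, 0, 0, 0, 0, 0, by simp, by simp, by simpa using hK, ⟨by simp, ?_⟩, ?_,
      by simp, by simp, by simp, fun t _ => ?_, fun V _ => by simp⟩
    · simp [Real.zero_rpow hq0]
    · intro s _ n
      simpa using (jamesSum_zero q hq.out s n).le
    · rw [sub_self]; rfl
  | succ i ih =>
    obtain ⟨x, z, y, w, W, T, N, hyw, hyT, hyK, hW, hw, hg, hx, hz, hN⟩ :=
      ih (r + 1) (by omega)
    set e := JamesSpace.unitVec p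
    -- D will be bounded by 2δ on [0, T], so its truncation there has variation at most η.
    obtain ⟨δ, hδ, hδη⟩ : ∃ δ > 0, (2 * (2 * δ)) ^ q * ((T : ℝ) + 1) ≤ η ^ q := by
      have h1 : Tendsto (fun δ : ℝ => (2 * (2 * δ)) ^ q * ((T : ℝ) + 1)) (𝓝 0)
          (𝓝 ((2 * (2 * 0)) ^ q * ((T : ℝ) + 1))) := by
        refine Tendsto.mul_const _ (Tendsto.rpow_const ?_ (Or.inr (by linarith [hq.out])))
        exact (tendsto_id.const_mul 2).const_mul 2
      have h2 : (2 * (2 * (0 : ℝ))) ^ q * ((T : ℝ) + 1) < η ^ q := by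
        simp only [mul_zero, Real.zero_rpow hq0, zero_mul]
        positivity
      have h3 := (h1.eventually_lt_const h2).filter_mono (nhdsWithin_le_nhds (s := Set.Ioi 0))
      obtain ⟨δ, h4, h5⟩ := (h3.and self_mem_nhdsWithin).exists
      exact ⟨δ, h5, h4.le⟩
    obtain ⟨n, hNn, hnT, hng⟩ := exists_translate he hf r x N T hδ (half_pos hε)
    obtain ⟨m, hnm, hmT, hmg⟩ := exists_translate he hf r z n T hδ (half_pos hε)
    have hg' : ∀ a j, a + j = r →
        |(shiftLim e)^[a] (iterLimTop e f j) (x + e n) -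
          (shiftLim e)^[a] (iterLimTop e f j) (z + e m)| ≤ ((i + 1 : ℕ) : ℝ) * ε := by
      intro a j haj
      have h1 := abs_le.1 (hng a j haj)
      have h2 := abs_le.1 (hmg a j haj)
      have h3 := abs_le.1 (hg (a + 1) j (by omega))
      push_cast
      rw [abs_le]
      constructor <;> linarith
    set D : ℕ → ℝ := (iterLim e f r (x + e n) - iterLim e f (r + 1) x) -
      (iterLim e f r (z + e m) - iterLim e f (r + 1) z) with hD
    have hDvar : VarLe q D (4 * K) := by
      have := (varLe_iterLim_step he hf r x n).sub hq.out (varLe_iterLim_step he hf r z m)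
      convert this using 1; ring
    have hDK : ∀ t, |D t| ≤ 4 * K := fun t => by
      have h1 := abs_iterLim_step he hf r x n t
      have h2 := abs_iterLim_step he hf r z m t
      simp only [hD, Pi.sub_apply]
      exact (abs_sub _ _).trans (by linarith)
    have hDT : ∀ t ≤ T, |D t| ≤ 2 * δ := fun t ht => by
      have h1 := hnT t ht
      have h2 := hmT t ht
      simp only [hD, Pi.sub_apply]
      exact (abs_sub _ _).trans (by linarith)
    have hDlim : Tendsto D atTop (𝓝 ((iterLimTop e f r (x + e n) - iterLimTop e f (r + 1) x) -
        (iterLimTop e f r (z + e m) - iterLimTop e f (r + 1) z))) :=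
      ((tendsto_iterLimTop he hf r _).sub (tendsto_iterLimTop he hf (r + 1) _)).sub
        ((tendsto_iterLimTop he hf r _).sub (tendsto_iterLimTop he hf (r + 1) _))
    -- The old and new discrepancies at infinity are at most i ε and (i + 1) ε, and 2i + 1 ≤ 2k + 1.
    have hDtop : |(iterLimTop e f r (x + e n) - iterLimTop e f (r + 1) x) -
        (iterLimTop e f r (z + e m) - iterLimTop e f (r + 1) z)| < η / 2 := by
      have h1 := abs_le.1 (hg 0 (r + 1) (by omega))
      have h2 := abs_le.1 (hg' 0 r (by omega))
      simp only [Function.iterate_zero, id_eq] at h1 h2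
      have h3 : (i : ℝ) + 1 ≤ k := by exact_mod_cast (by omega : i + 1 ≤ k)
      have h4 := mul_le_mul_of_nonneg_right h3 hε.le
      push_cast at h2
      rw [abs_lt]
      constructor <;> linarith
    obtain ⟨T', hTT', htail⟩ := exists_varLe_truncate_tail hq.out hDvar hDlim hDtop T
    have hinit := varLe_truncate_init hq.out (by positivity) hη.le hDT hδη
    obtain ⟨V, hV⟩ := hDvar.exists_control hq.out (by positivity)
    obtain ⟨U, hU⟩ := hW.append_block (T := T) (T' := T') hq.out hyK hV hDK
    -- D is cut at T and T': the middle joins y as a new block, the head and the tail join w at a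
    -- cost of η each.
    refine ⟨x + e n, z + e m, fun t => if t ≤ T then y t else if t ≤ T' then D t else 0, w + ((fun t => if t ≤ T then D t else 0) +
      fun t => if t ≤ T' then 0 else D t), U, T', m, ?_, ?_, ?_, ?_, ?_, hg', ?_, ?_, ?_⟩
    rotate_left 3
    · convert hU using 1
      push_cast; ring
    · convert hw.add hq.out (hinit.add hq.out htail) using 1
      push_cast; ring
    · push_cast
      linarith [norm_add_le x (e n), he n]
    · push_cast
      linarith [norm_add_le z (e m), he m]
    · push_cast
      have h1 := hN.add_single_sub_single hp.out hNn hnm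
      convert h1 using 1
      rw [add_sub_add_comm]
      rfl
    · have h1 : iterLim e f r (x + e n) - iterLim e f r (z + e m) = (y + w) + D := by
        rw [← hyw, hD]; abel
      rw [h1]
      ext t
      simp only [Pi.add_apply]
      by_cases ht : t ≤ T
      · simp only [ht, ht.trans hTT', if_true]; ring
      · have := hyT t (by omega)
        by_cases ht' : t ≤ T'
        · simp only [ht, ht', this, if_true, if_false]; ring
        · simp only [ht, ht', this, if_false]; ring
    · intro t ht
      dsimp only
      rw [if_neg (by omega), if_neg (by omega)]
    · intro t
      dsimp only
      split_ifs
      · exact hyK t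
      · exact hDK t
      · simpa using hK

/-- A map `J_p → J_q` that is bounded at scale `2` contracts suitable pairs of norm at most `2k`
and distance at least `k^{1/p}` to distance `O(k^{1/q})`. -/
theorem exists_interlaced_norm_le {p q : ℝ} [hp : Fact (1 ≤ p)] [hq : Fact (1 ≤ q)]
    {f : JamesSpace p → JamesSpace q} {K : ℝ} (hK : 0 ≤ K)
    (hf : ∀ x y, ‖x - y‖ ≤ 2 → ‖f x - f y‖ ≤ K) (k : ℕ) :
    ∃ x z : JamesSpace p, ‖x‖ ≤ 2 * k ∧ ‖z‖ ≤ 2 * k ∧ (k : ℝ) ^ p⁻¹ ≤ ‖x - z‖ ∧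
      ‖f x - f z‖ ≤ (k * (3 * (2 * (4 * K)) ^ q)) ^ q⁻¹ + 1 := by
  have hq0 : q ≠ 0 := by linarith [hq.out]
  have hp0 : 0 < p := by linarith [hp.out]
  obtain ⟨η, hη, hkη⟩ : ∃ η : ℝ, 0 < η ∧ k * (2 * η) ≤ 1 :=
    ⟨(2 * ((k : ℝ) + 1))⁻¹, by positivity, by field_simp; linarith⟩
  obtain ⟨ε, hε, hεη⟩ : ∃ ε : ℝ, 0 < ε ∧ (2 * k + 1) * ε < η / 2 :=
    ⟨η / (2 * (2 * (k : ℝ) + 2)), by positivity, by field_simp; linarith⟩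
  obtain ⟨x, z, y, w, W, T, N, hyw, -, -, hW, hw, -, hx, hz, hN⟩ :=
    exists_interlaced hK hf hε hη k hεη k 0 (by omega)
  refine ⟨x, z, hx, hz, ?_, ?_⟩
  · rw [Real.rpow_inv_le_iff_of_pos (by positivity) (norm_nonneg _) hp0]
    exact hN.le_rpow hp.out (x - z).varLe_norm
  · have hA : 0 ≤ k * (3 * (2 * (4 * K)) ^ q) := by positivity
    have h1 : VarLe q y ((k * (3 * (2 * (4 * K)) ^ q)) ^ q⁻¹) := by
      refine IsControl.varLe hq.out (by positivity) (V := W) ?_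
      rwa [Real.rpow_inv_rpow hA hq0]
    have h2 : VarLe q (f x - f z).seq ((k * (3 * (2 * (4 * K)) ^ q)) ^ q⁻¹ + k * (2 * η)) := by
      have h3 : (f x - f z).seq = y + w := hyw
      rw [h3]
      exact h1.add hq.out hw
    exact (JamesSpace.norm_le_of_forall _ fun s hs n => h2 s hs n).trans (by linarith)

/-! ### Comparison with the expansion rate -/

theorem IsCoarseMap.exists_bound {X Y : Type*} [NormedAddCommGroup X] [NormedAddCommGroup Y]
    {f : X → Y} (h : IsCoarseMap f) {t : ℝ} (ht : 0 ≤ t) :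
    ∃ K, 0 ≤ K ∧ ∀ x y, ‖x - y‖ ≤ t → ‖f x - f y‖ ≤ K := by
  refine ⟨(coarseModulus f t).toReal, ENNReal.toReal_nonneg, fun x y hxy => ?_⟩
  rw [← dist_eq_norm, dist_edist]
  refine ENNReal.toReal_mono (h t ht).ne ?_
  exact le_iSup_of_le x (le_iSup_of_le y (le_iSup_of_le (by rwa [dist_eq_norm]) le_rfl))

theorem corollary4p8 (p q : ℝ) [Fact (1 ≤ p)] [Fact (1 ≤ q)] (hpq : p < q) :
    ¬ ∃ f : JamesSpace p → JamesSpace q,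
      IsCoarseMap f ∧ IsLinearlyExpandingAtRate (1 / q) f := by
  rintro ⟨f, hcoarse, hexp⟩
  have hp : 1 ≤ p := Fact.out
  have hq0 : 0 < q := by linarith
  obtain ⟨K, hK, hf⟩ := hcoarse.exists_bound (zero_le_two (α := ℝ))
  obtain ⟨C, hC, hfC⟩ := hexp 1 one_pos
  have hlt : 0 < p⁻¹ - q⁻¹ := sub_pos.2 (inv_strictAnti₀ (by linarith) hpq)
  set A : ℝ := (3 * (2 * (4 * K)) ^ q) ^ q⁻¹
  -- After scaling by k^{1/q}, the first summand exceeds the expansion threshold for L = 1, and the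
  -- second the bound on ‖x - z‖ that expansion then gives.
  set R : ℝ := (2 ^ q⁻¹ + 1) + C * (A + 1 + C)
  have hA : 0 ≤ A := by positivity
  have hR : Tendsto (fun k : ℕ => (k : ℝ) ^ (p⁻¹ - q⁻¹)) atTop atTop :=
    (tendsto_rpow_atTop hlt).comp tendsto_natCast_atTop_atTop
  obtain ⟨k, hkR, hk⟩ := ((hR.eventually_gt_atTop R).and (eventually_ge_atTop 1)).exists
  have hk1 : (1 : ℝ) ≤ k := by exact_mod_cast hk
  have hs : 1 ≤ (k : ℝ) ^ q⁻¹ := Real.one_le_rpow hk1 (by positivity)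
  have hsplit : (k : ℝ) ^ p⁻¹ = (k : ℝ) ^ q⁻¹ * (k : ℝ) ^ (p⁻¹ - q⁻¹) := by
    rw [← Real.rpow_add (by linarith)]; congr 1; ring
  obtain ⟨x, z, hx, hz, hxz, hfxz⟩ := exists_interlaced_norm_le hK hf k
  set s : ℝ := (k : ℝ) ^ q⁻¹
  have hbig : s * R < ‖x - z‖ := by
    refine lt_of_lt_of_le ?_ hxz
    rw [hsplit]
    exact mul_lt_mul_of_pos_left hkR (by linarith)
  have hpow : ∀ v : JamesSpace p, ‖v‖ ≤ 2 * k → ‖v‖ ^ (1 / q) ≤ 2 ^ q⁻¹ * s := fun v hv => by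
    rw [one_div, ← Real.mul_rpow (by norm_num) (by positivity)]
    exact Real.rpow_le_rpow (norm_nonneg _) hv (by positivity)
  have hCA : 0 ≤ C * (A + 1 + C) := by positivity
  have h2 : (0 : ℝ) ≤ 2 ^ q⁻¹ := by positivity
  have hRs : s * R = (2 ^ q⁻¹ * s + s) + C * (A * s + s + C * s) := by ring
  have hpos : 0 ≤ C * (A * s + s + C * s) := by positivity
  have hlow := hfC x z (by
    have := max_le (hpow x hx) (hpow z hz)
    linarith)
  have hup : ‖f x - f z‖ ≤ A * s + 1 := by
    rwa [mul_comm (k : ℝ), Real.mul_rpow (by positivity) (by positivity)] at hfxz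
  have h3 : ‖x - z‖ ≤ C * (A * s + 1 + C) := by
    rw [← div_le_iff₀' hC]; linarith
  have h4 : C * (A * s + 1 + C) ≤ C * (A * s + s + C * s) := by
    refine mul_le_mul_of_nonneg_left ?_ hC.le
    have := le_mul_of_one_le_right hC.le hs
    linarith
  have h5 : 0 ≤ 2 ^ q⁻¹ * s := by positivity
  linarith
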